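/- Let $t_0\in\mathbb R$ and let $p,q,r:[t_0,+\infty)\to\mathbb R$ be continuous with $p(t)>0$ for $t\ge t_0$. Consider the Riccati equation $$\alpha'(t)+\frac{1}{p(t)}\alpha^2(t)+\frac{q(t)}{p(t)}\alpha(t)+r(t)=0,\qquad t\ge t_0. \tag{2.7}$$ A solution of (2.7) is called $t_0$-regular if it exists on $[t_0,+\infty)$. A $t_0$-regular solution $\alpha$ is called $t_0$-normal if there is a neighbourhood $U$ of $\alpha(t_0)$ such that every solution $\widetilde\alpha$ with $\widetilde\alpha(t_0)\in U$ is $t_0$-regular; otherwise it is called $t_0$-extremal. A $t_0$-extremal solution $\alpha$ is called lower $t_0$-extremal if no solution $\widetilde\alpha$ with $\widetilde\alpha(t_0)<\alpha(t_0)$ is $t_0$-regular. Suppose that a) $r(t)\le 0$ for all $t\ge t_0$; b) $\displaystyle I(t_0):=\int_{t_0}^{+\infty}\exp\Bigl\{-\int_{t_0}^{\tau}\frac{q(s)}{p(s)}\,ds\Bigr\}\frac{d\tau}{p(\tau)}=+\infty$; c) $\displaystyle \int_{t_0}^{+\infty}|r(t)|\Bigl(\int_{t_0}^{t}\exp\Bigl\{\int_{\tau}^{t}\frac{q(s)}{p(s)}\,ds\Bigr\}\frac{d\tau}{p(\tau)}\Bigr)dt<+\infty$.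 Then equation (2.7) has a unique lower $t_0$-extremal solution $\alpha_*$ on $[t_0,+\infty)$, and the integral $\displaystyle\int_{t_0}^{+\infty}\frac{\alpha_*(\tau)}{p(\tau)}\,d\tau=\lim_{t\to+\infty}\int_{t_0}^{t}\frac{\alpha_*(\tau)}{p(\tau)}\,d\tau$ converges (to a finite limit). -/

import Mathlib

open Set Filter Topology MeasureTheory
open scoped ENNReal

/-- `α` solves the Riccati equation `α' + α² / p + (q / p) α + r = 0` on `[t₁, +∞)`, that is, it is a
`t₁`-regular solution. The derivative at the end point `t₁` is the right-hand one; at `t > t₁` it is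
the ordinary derivative. Values of `α` to the left of `t₁` play no role. -/
def IsRegularSolution (p q r : ℝ → ℝ) (t₁ : ℝ) (α : ℝ → ℝ) : Prop :=
  ∀ t ∈ Ici t₁,
    HasDerivWithinAt α (-((1 / p t) * α t ^ 2 + (q t / p t) * α t + r t)) (Ici t₁) t

/-- A `t₁`-regular solution `α` is `t₁`-normal if there is a neighbourhood `U` of `α t₁` such that the
solutions with initial value in `U` at `t₁` are all `t₁`-regular. (The solution with a given initial
value is unique, so this says that for each `x ∈ U` a solution starting at `x` exists on
`[t₁, +∞)`.) -/
def IsNormalSolution (p q r : ℝ → ℝ) (t₁ : ℝ) (α : ℝ → ℝ) : Prop :=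
  IsRegularSolution p q r t₁ α ∧
    ∃ U ∈ 𝓝 (α t₁), ∀ x ∈ U, ∃ β : ℝ → ℝ, IsRegularSolution p q r t₁ β ∧ β t₁ = x

/-- A `t₁`-extremal solution: `t₁`-regular, but not `t₁`-normal. -/
def IsExtremalSolution (p q r : ℝ → ℝ) (t₁ : ℝ) (α : ℝ → ℝ) : Prop :=
  IsRegularSolution p q r t₁ α ∧ ¬ IsNormalSolution p q r t₁ α

/-- A lower `t₁`-extremal solution: a `t₁`-extremal solution such that no solution with a smaller
initial value at `t₁` is `t₁`-regular. -/
def IsLowerExtremalSolution (p q r : ℝ → ℝ) (t₁ : ℝ) (α : ℝ → ℝ) : Prop :=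
  IsExtremalSolution p q r t₁ α ∧
    ∀ β : ℝ → ℝ, β t₁ < α t₁ → ¬ IsRegularSolution p q r t₁ β

/-- The integral `I(t) = ∫_t^∞ exp(-∫_t^τ q / p) dτ / p(τ)`, whose integrand is positive,
as an element of `[0, ∞]`. -/
noncomputable def riccatiI (p q : ℝ → ℝ) (t : ℝ) : ℝ≥0∞ :=
  ∫⁻ τ in Ioi t, ENNReal.ofReal (Real.exp (-∫ s in t..τ, q s / p s) / p τ)

/-! With `E = exp ∫ q/p`, the substitution `y = E α` gives `y' = R - P y²`, where `P = 1/(p E) > 0`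
and `R = -r E ≥ 0`. For `A = ∫ P`, hypothesis b) says `A → ∞` and c) says `∫ A R < ∞`. This Riccati
equation linearizes, via `y = ψ/φ`, to `φ' = P ψ`, `ψ' = R φ`.

Finiteness of `∫ A R` yields a solution `φ` bounded, at least `1` and tending to `1`: the fixed
point of `φ = 1 + ∫_t^∞ (A u - A t) R φ du` (`exists_volterraTail_fixedPoint`). Its quotient `ψ/φ`
is the minimal global solution (`principal_le_of_riccati`): a solution starting lower would have to
blow up, because `∫ P/φ²` diverges. Finally `α/p = P y = φ'/φ`, so the integral is `log φ(t) - log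
φ(t₀)`, which tends to `-log φ(t₀)`. -/

/-- The Volterra operator `f ↦ ∫_t^∞ (A u - A t) R u f u du` on `[a, ∞)`, extended to the left of `a`
by its value at `a`. -/
noncomputable def volterraTail (a : ℝ) (A R f : ℝ → ℝ) (t : ℝ) : ℝ :=
  ∫ u in Ioi (max a t), (A u - A (max a t)) * (R u * f u)

/-! ### The Volterra equation with condition at infinity -/

section Volterra

variable {a M : ℝ} {A R f g : ℝ → ℝ}

lemma MeasureTheory.IntegrableOn.mul_of_bounded {s : Set ℝ} (hR : IntegrableOn R s)
    (hf : Measurable f) (h0 : ∀ t, 0 ≤ f t) (hM : ∀ t, f t ≤ M) :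
    IntegrableOn (fun u => R u * f u) s := by
  have := Integrable.bdd_mul (c := M) hR hf.aestronglyMeasurable
    (ae_of_all _ fun t => by rw [Real.norm_eq_abs, abs_of_nonneg (h0 t)]; exact hM t)
  exact this.congr (ae_of_all _ fun u => mul_comm _ _)

lemma volterraTail_integrand_integrableOn (hRi : IntegrableOn R (Ioi a))
    (hARi : IntegrableOn (fun u => A u * R u) (Ioi a)) (hf : Measurable f) (h0 : ∀ t, 0 ≤ f t)
    (hM : ∀ t, f t ≤ M) (c : ℝ) :
    IntegrableOn (fun u => (A u - c) * (R u * f u)) (Ioi a) := by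
  have h1 := hARi.mul_of_bounded hf h0 hM
  have h2 := (hRi.mul_of_bounded hf h0 hM).const_mul c
  refine (h1.sub h2).congr (ae_of_all _ fun u => ?_)
  simp only [Pi.sub_apply]
  ring

lemma setIntegral_Ioi_eq_sub {h : ℝ → ℝ} (hh : IntegrableOn h (Ioi a)) {t : ℝ} (ht : a ≤ t) :
    ∫ u in Ioi t, h u = (∫ u in Ioi a, h u) - ∫ u in a..t, h u := by
  rw [← intervalIntegral.integral_interval_add_Ioi hh (hh.mono_set (Ioi_subset_Ioi ht))]
  ring

/-- Splitting the kernel leaves `t` only in `A` and in primitives based at `a`, which makes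
continuity and differentiation in `t` immediate. -/
lemma volterraTail_eq (hRi : IntegrableOn R (Ioi a))
    (hARi : IntegrableOn (fun u => A u * R u) (Ioi a)) (hf : Measurable f) (h0 : ∀ t, 0 ≤ f t)
    (hM : ∀ t, f t ≤ M) (t : ℝ) :
    volterraTail a A R f t =
      ((∫ u in Ioi a, A u * R u * f u) - ∫ u in a..max a t, A u * R u * f u) -
        A (max a t) * ((∫ u in Ioi a, R u * f u) - ∫ u in a..max a t, R u * f u) := by
  have h1 := hARi.mul_of_bounded hf h0 hM
  have h2 := hRi.mul_of_bounded hf h0 hM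
  have ht : a ≤ max a t := le_max_left _ _
  rw [← setIntegral_Ioi_eq_sub h1 ht, ← setIntegral_Ioi_eq_sub h2 ht, ← integral_const_mul,
    ← integral_sub (h1.mono_set (Ioi_subset_Ioi ht))
      ((h2.mono_set (Ioi_subset_Ioi ht)).const_mul _), volterraTail]
  congr 1 with u
  ring

lemma continuous_volterraTail (hA : Continuous A) (hR : Continuous R)
    (hRi : IntegrableOn R (Ioi a)) (hARi : IntegrableOn (fun u => A u * R u) (Ioi a))
    (hf : Measurable f) (h0 : ∀ t, 0 ≤ f t) (hM : ∀ t, f t ≤ M) :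
    Continuous (volterraTail a A R f) := by
  have prim : ∀ h : ℝ → ℝ, Continuous h → Continuous fun t => ∫ u in a..t, h u * f u := by
    intro h hh
    refine intervalIntegral.continuous_primitive (fun x y => ?_) a
    exact ⟨((hh.intervalIntegrable x y).1).mul_of_bounded hf h0 hM,
      ((hh.intervalIntegrable x y).2).mul_of_bounded hf h0 hM⟩
  have hm : Continuous fun t => max a t := by fun_prop
  rw [funext fun t => volterraTail_eq hRi hARi hf h0 hM t]
  have p1 := (prim _ (hA.mul hR)).comp hm
  have p2 := (prim _ hR).comp hm
  have p3 := hA.comp hm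
  exact (continuous_const.sub p1).sub (p3.mul (continuous_const.sub p2))

lemma volterraTail_nonneg (hA : Monotone A) (hR : ∀ t, 0 ≤ R t) (h0 : ∀ t, 0 ≤ f t) (t : ℝ) :
    0 ≤ volterraTail a A R f t :=
  setIntegral_nonneg measurableSet_Ioi fun u hu =>
    mul_nonneg (sub_nonneg.2 (hA (mem_Ioi.1 hu).le)) (mul_nonneg (hR u) (h0 u))

lemma volterraTail_mono {M' : ℝ} (hA : Monotone A) (hR : ∀ t, 0 ≤ R t)
    (hRi : IntegrableOn R (Ioi a)) (hARi : IntegrableOn (fun u => A u * R u) (Ioi a))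
    (hf : Measurable f) (h0 : ∀ t, 0 ≤ f t) (hM : ∀ t, f t ≤ M)
    (hg : Measurable g) (h0' : ∀ t, 0 ≤ g t) (hM' : ∀ t, g t ≤ M') (hfg : ∀ t, f t ≤ g t) (t : ℝ) :
    volterraTail a A R f t ≤ volterraTail a A R g t := by
  have ht : a ≤ max a t := le_max_left _ _
  refine setIntegral_mono_on
    ((volterraTail_integrand_integrableOn hRi hARi hf h0 hM _).mono_set (Ioi_subset_Ioi ht))
    ((volterraTail_integrand_integrableOn hRi hARi hg h0' hM' _).mono_set (Ioi_subset_Ioi ht))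
    measurableSet_Ioi fun u hu => ?_
  exact mul_le_mul_of_nonneg_left (mul_le_mul_of_nonneg_left (hfg u) (hR u))
    (sub_nonneg.2 (hA (mem_Ioi.1 hu).le))

lemma volterraTail_le (hAm : Monotone A) (hAa : A a = 0) (hR : ∀ t, 0 ≤ R t)
    (hRi : IntegrableOn R (Ioi a)) (hARi : IntegrableOn (fun u => A u * R u) (Ioi a))
    (hf : Measurable f) (h0 : ∀ t, 0 ≤ f t) (hM : ∀ t, f t ≤ M) (t : ℝ) :
    volterraTail a A R f t ≤ ∫ u in Ioi (max a t), A u * R u * f u := by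
  have ht : a ≤ max a t := le_max_left _ _
  refine setIntegral_mono_on
    ((volterraTail_integrand_integrableOn hRi hARi hf h0 hM _).mono_set (Ioi_subset_Ioi ht))
    ((hARi.mul_of_bounded hf h0 hM).mono_set (Ioi_subset_Ioi ht)) measurableSet_Ioi fun u hu => ?_
  have h1 : 0 ≤ A (max a t) := hAa ▸ hAm ht
  have h2 : 0 ≤ A (max a t) * (R u * f u) := mul_nonneg h1 (mul_nonneg (hR u) (h0 u))
  linarith

/-- The tail integral `∫_t^∞ A R`, extended to the left of `a` by its value at `a`. -/
noncomputable def tailMass (a : ℝ) (A R : ℝ → ℝ) (t : ℝ) : ℝ :=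
  ∫ u in Ioi (max a t), A u * R u

lemma tailMass_le (hAm : Monotone A) (hAa : A a = 0) (hR : ∀ t, 0 ≤ R t)
    (hARi : IntegrableOn (fun u => A u * R u) (Ioi a)) (t : ℝ) :
    tailMass a A R t ≤ tailMass a A R a := by
  unfold tailMass
  rw [max_self]
  refine setIntegral_mono_set hARi ?_ (Ioi_subset_Ioi (le_max_left _ _)).eventuallyLE
  filter_upwards [ae_restrict_mem measurableSet_Ioi] with u hu
  exact mul_nonneg (hAa ▸ hAm (mem_Ioi.1 hu).le) (hR u)

lemma continuous_tailMass (hA : Continuous A) (hR : Continuous R)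
    (hARi : IntegrableOn (fun u => A u * R u) (Ioi a)) : Continuous (tailMass a A R) := by
  rw [show tailMass a A R = _ from funext fun t => setIntegral_Ioi_eq_sub hARi (le_max_left a t)]
  have h := intervalIntegral.continuous_primitive (μ := volume)
    (fun x y => (hA.mul hR).intervalIntegrable x y) a
  exact continuous_const.sub (h.comp (by fun_prop : Continuous fun t => max a t))

lemma tendsto_setIntegral_Ioi_atTop {h : ℝ → ℝ} (hh : IntegrableOn h (Ioi a)) :
    Tendsto (fun t => ∫ u in Ioi t, h u) atTop (𝓝 0) := by
  have h1 := (intervalIntegral_tendsto_integral_Ioi a hh tendsto_id).const_sub (∫ u in Ioi a, h u)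
  rw [sub_self] at h1
  refine h1.congr' ?_
  filter_upwards [eventually_ge_atTop a] with t ht
  exact (setIntegral_Ioi_eq_sub hh ht).symm

/-- The function `exp (tailMass a A R)` has derivative `-A R` times itself on `(a, ∞)` and tends to
`1`. It is therefore fixed by `f ↦ 1 + ∫_t^∞ A R f`, which dominates the Volterra map, and so it is
a supersolution bounding all iterates. -/
lemma setIntegral_mul_exp_tailMass (hA : Continuous A) (hR : Continuous R)
    (hAm : Monotone A) (hAa : A a = 0) (hR0 : ∀ t, 0 ≤ R t)
    (hARi : IntegrableOn (fun u => A u * R u) (Ioi a)) (t : ℝ) :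
    ∫ u in Ioi (max a t), A u * R u * Real.exp (tailMass a A R u) =
      Real.exp (tailMass a A R t) - 1 := by
  have ht : a ≤ max a t := le_max_left _ _
  have hcont := Real.continuous_exp.comp (continuous_tailMass hA hR hARi)
  have hint : IntegrableOn (fun u => -(A u * R u * Real.exp (tailMass a A R u)))
      (Ioi (max a t)) :=
    ((hARi.mul_of_bounded hcont.measurable (fun _ => (Real.exp_pos _).le)
      (fun u => Real.exp_le_exp.2 (tailMass_le hAm hAa hR0 hARi u))).mono_set
        (Ioi_subset_Ioi ht)).neg
  have hder : ∀ u ∈ Ioi (max a t), HasDerivAt (fun u => Real.exp (tailMass a A R u))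
      (-(A u * R u * Real.exp (tailMass a A R u))) u := by
    intro u hu
    have hau : a < u := ht.trans_lt hu
    have h1 : HasDerivAt (fun t => (∫ u in Ioi a, A u * R u) - ∫ u in a..t, A u * R u)
        (-(A u * R u)) u :=
      ((hA.mul hR).integral_hasStrictDerivAt a u).hasDerivAt.const_sub _
    have h2 : HasDerivAt (tailMass a A R) (-(A u * R u)) u := by
      refine h1.congr_of_eventuallyEq ?_
      filter_upwards [lt_mem_nhds hau] with v hv
      rw [tailMass, max_eq_right hv.le, setIntegral_Ioi_eq_sub hARi hv.le]
    convert h2.exp using 1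
    ring
  have hlim : Tendsto (fun u => Real.exp (tailMass a A R u)) atTop (𝓝 1) := by
    have h1 : Tendsto (tailMass a A R) atTop (𝓝 0) := by
      refine (tendsto_setIntegral_Ioi_atTop hARi).congr' ?_
      filter_upwards [eventually_ge_atTop a] with u hu
      rw [tailMass, max_eq_right hu]
    have h2 := (Real.continuous_exp.tendsto 0).comp h1
    rwa [Real.exp_zero] at h2
  have := integral_Ioi_of_hasDerivAt_of_tendsto hcont.continuousWithinAt hder hint hlim
  rw [integral_neg] at this
  simp only [Function.comp_apply] at this
  have hmm : tailMass a A R (max a t) = tailMass a A R t := by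
    unfold tailMass
    rw [max_eq_right ht]
  rw [hmm] at this
  linarith

/-- Successive approximations to the solution of `φ = 1 + volterraTail a A R φ`. -/
noncomputable def volterraIter (a : ℝ) (A R : ℝ → ℝ) : ℕ → ℝ → ℝ
  | 0 => fun _ => 0
  | n + 1 => fun t => 1 + volterraTail a A R (volterraIter a A R n) t

lemma volterraIter_bounds (hA : Continuous A) (hR : Continuous R)
    (hAm : Monotone A) (hAa : A a = 0) (hR0 : ∀ t, 0 ≤ R t) (hRi : IntegrableOn R (Ioi a))
    (hARi : IntegrableOn (fun u => A u * R u) (Ioi a)) (n : ℕ) :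
    Continuous (volterraIter a A R n) ∧ (∀ t, 0 ≤ volterraIter a A R n t) ∧
      ∀ t, volterraIter a A R n t ≤ Real.exp (tailMass a A R t) := by
  have hE := Real.continuous_exp.comp (continuous_tailMass hA hR hARi)
  have hEM : ∀ t, Real.exp (tailMass a A R t) ≤ Real.exp (tailMass a A R a) :=
    fun t => Real.exp_le_exp.2 (tailMass_le hAm hAa hR0 hARi t)
  induction n with
  | zero => exact ⟨continuous_const, fun _ => le_rfl, fun t => (Real.exp_pos _).le⟩
  | succ n ih =>
    obtain ⟨hc, h0, hle⟩ := ih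
    have hM := fun t => (hle t).trans (hEM t)
    refine ⟨continuous_const.add (continuous_volterraTail hA hR hRi hARi hc.measurable h0 hM),
      fun t => add_nonneg zero_le_one (volterraTail_nonneg hAm hR0 h0 t), fun t => ?_⟩
    have h1 := volterraTail_mono hAm hR0 hRi hARi hc.measurable h0 hM hE.measurable
      (fun _ => (Real.exp_pos _).le) hEM hle t
    have h2 := volterraTail_le hAm hAa hR0 hRi hARi hE.measurable
      (fun _ => (Real.exp_pos _).le) hEM t
    have h3 := setIntegral_mul_exp_tailMass hA hR hAm hAa hR0 hARi t
    simp only [Function.comp_apply] at h2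
    have h4 : volterraIter a A R (n + 1) t = 1 + volterraTail a A R (volterraIter a A R n) t := rfl
    linarith

/-- The operator is monotone, so the iterates from `0` increase; the supersolution bounds them, and
dominated convergence passes to the limit. No smallness of `∫ A R` is needed. -/
theorem exists_volterraTail_fixedPoint (hA : Continuous A) (hR : Continuous R)
    (hAm : Monotone A) (hAa : A a = 0) (hR0 : ∀ t, 0 ≤ R t) (hRi : IntegrableOn R (Ioi a))
    (hARi : IntegrableOn (fun u => A u * R u) (Ioi a)) :
    ∃ (φ : ℝ → ℝ) (M : ℝ), Continuous φ ∧ (∀ t, 1 ≤ φ t) ∧ (∀ t, φ t ≤ M) ∧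
      ∀ t, φ t = 1 + volterraTail a A R φ t := by
  have hEM : ∀ t, Real.exp (tailMass a A R t) ≤ Real.exp (tailMass a A R a) :=
    fun t => Real.exp_le_exp.2 (tailMass_le hAm hAa hR0 hARi t)
  set M := Real.exp (tailMass a A R a) with hMdef
  have hB := volterraIter_bounds hA hR hAm hAa hR0 hRi hARi
  have hc := fun n => (hB n).1
  have h0 := fun n => (hB n).2.1
  have hM := fun n t => ((hB n).2.2 t).trans (hEM t)
  have hmono : ∀ n t, volterraIter a A R n t ≤ volterraIter a A R (n + 1) t := by
    intro n
    induction n with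
    | zero => exact fun t => h0 1 t
    | succ n ih =>
      exact fun t => by
        have := volterraTail_mono hAm hR0 hRi hARi (hc n).measurable (h0 n) (hM n)
          (hc (n + 1)).measurable (h0 (n + 1)) (hM (n + 1)) ih t
        exact add_le_add_right this 1
  set φ : ℝ → ℝ := fun t => ⨆ n, volterraIter a A R n t
  have hlim : ∀ t, Tendsto (fun n => volterraIter a A R n t) atTop (𝓝 (φ t)) := fun t =>
    tendsto_atTop_ciSup (monotone_nat_of_le_succ fun n => hmono n t)
      ⟨M, by rintro _ ⟨n, rfl⟩; exact hM n t⟩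
  have hφm : Measurable φ :=
    measurable_of_tendsto_metrizable (fun n => (hc n).measurable) (tendsto_pi_nhds.2 hlim)
  have hφ0 : ∀ t, 0 ≤ φ t := fun t => ge_of_tendsto' (hlim t) fun n => h0 n t
  have hφM : ∀ t, φ t ≤ M := fun t => le_of_tendsto' (hlim t) fun n => hM n t
  have hfix : ∀ t, φ t = 1 + volterraTail a A R φ t := by
    intro t
    have ht : a ≤ max a t := le_max_left _ _
    have h1 : Tendsto (fun n => volterraTail a A R (volterraIter a A R n) t) atTop
        (𝓝 (volterraTail a A R φ t)) := by
      refine tendsto_integral_of_dominated_convergence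
        (fun u => (A u - A (max a t)) * (R u * M)) (fun n => ?_) ?_ (fun n => ?_) ?_
      · exact ((hA.sub continuous_const).mul (hR.mul (hc n))).aestronglyMeasurable
      · exact (volterraTail_integrand_integrableOn hRi hARi (f := fun _ => M) measurable_const
          (fun _ => (Real.exp_pos _).le) (fun _ => le_rfl) _).mono_set (Ioi_subset_Ioi ht)
      · filter_upwards [ae_restrict_mem measurableSet_Ioi] with u hu
        have h2 : 0 ≤ A u - A (max a t) := sub_nonneg.2 (hAm (mem_Ioi.1 hu).le)
        rw [Real.norm_of_nonneg (mul_nonneg h2 (mul_nonneg (hR0 u) (h0 n u)))]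
        exact mul_le_mul_of_nonneg_left (mul_le_mul_of_nonneg_left (hM n u) (hR0 u)) h2
      · exact ae_of_all _ fun u => ((hlim u).const_mul _).const_mul _
    exact tendsto_nhds_unique ((tendsto_add_atTop_iff_nat 1).2 (hlim t)) (h1.const_add 1)
  refine ⟨φ, M, ?_, fun t => ?_, hφM, hfix⟩
  -- As a supremum `φ` is only known to be measurable; the equation itself upgrades it to
  -- continuous.
  · rw [funext hfix]
    exact continuous_const.add (continuous_volterraTail hA hR hRi hARi hφm hφ0 hφM)
  · rw [hfix t]
    linarith [volterraTail_nonneg (a := a) hAm hR0 hφ0 t]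

/-! ### The principal solution of the linear system -/

/-- The principal solution of the linear system `φ' = P ψ`, `ψ' = R φ` on `[a, ∞)`, where `A` is a
primitive of `P`. -/
theorem exists_principal_solution {P : ℝ → ℝ} (hP : ∀ t, 0 < P t)
    (hA : ∀ t, HasDerivAt A (P t) t) (hAa : A a = 0) (hR : Continuous R) (hR0 : ∀ t, 0 ≤ R t)
    (hRi : IntegrableOn R (Ioi a)) (hARi : IntegrableOn (fun u => A u * R u) (Ioi a)) :
    ∃ (φ ψ : ℝ → ℝ) (M : ℝ),
      (∀ t ∈ Ici a, HasDerivWithinAt φ (P t * ψ t) (Ici a) t) ∧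
      (∀ t ∈ Ici a, HasDerivWithinAt ψ (R t * φ t) (Ici a) t) ∧
      (∀ t, 1 ≤ φ t) ∧ (∀ t, φ t ≤ M) ∧ Tendsto φ atTop (𝓝 1) := by
  have hAc : Continuous A := continuous_iff_continuousAt.2 fun t => (hA t).continuousAt
  have hAm : Monotone A := monotone_of_hasDerivAt_nonneg hA fun t => (hP t).le
  obtain ⟨φ, M, hφc, hφ1, hφM, hfix⟩ :=
    exists_volterraTail_fixedPoint hAc hR hAm hAa hR0 hRi hARi
  have hφ0 : ∀ t, 0 ≤ φ t := fun t => zero_le_one.trans (hφ1 t)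
  -- This is `-∫_t^∞ R φ`, as dictated by differentiating the fixed-point equation.
  set ψ : ℝ → ℝ := fun t => -((∫ u in Ioi a, R u * φ u) - ∫ u in a..t, R u * φ u) with hψ
  have hd2 : ∀ t, HasDerivAt (fun t => ∫ u in a..t, R u * φ u) (R t * φ t) t := fun t =>
    ((hR.mul hφc).integral_hasStrictDerivAt a t).hasDerivAt
  have hd1 : ∀ t, HasDerivAt (fun t => ∫ u in a..t, A u * R u * φ u) (A t * R t * φ t) t :=
    fun t => (((hAc.mul hR).mul hφc).integral_hasStrictDerivAt a t).hasDerivAt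
  refine ⟨φ, ψ, M, fun t ht => ?_, fun t _ => ?_, hφ1, hφM, ?_⟩
  · have h := (((hd1 t).const_sub (∫ u in Ioi a, A u * R u * φ u)).sub
      ((hA t).mul ((hd2 t).const_sub (∫ u in Ioi a, R u * φ u)))).const_add 1
    have h' := h.hasDerivWithinAt (s := Ici a)
    refine (h'.congr_of_mem (fun s hs => ?_) ht).congr_deriv ?_
    · rw [hfix s, volterraTail_eq hRi hARi hφc.measurable hφ0 hφM, max_eq_right hs]
      rfl
    · simp only [hψ]
      ring
  · have h := ((hd2 t).const_sub (∫ u in Ioi a, R u * φ u)).neg.hasDerivWithinAt (s := Ici a)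
    rw [neg_neg] at h
    exact h
  · have h1 := (tendsto_setIntegral_Ioi_atTop
      (hARi.mul_of_bounded hφc.measurable hφ0 hφM)).const_add 1
    rw [add_zero] at h1
    refine tendsto_of_tendsto_of_tendsto_of_le_of_le' tendsto_const_nhds h1
      (Eventually.of_forall hφ1) ?_
    filter_upwards [eventually_ge_atTop a] with t ht
    have h2 := volterraTail_le hAm hAa hR0 hRi hARi hφc.measurable hφ0 hφM t
    rw [max_eq_right ht] at h2
    linarith [hfix t]

end Volterra

/-! ### Comparison with an arbitrary global Riccati solution -/

lemma eqOn_zero_of_hasDerivWithinAt_mul_self {a : ℝ} {c u : ℝ → ℝ} (hc : ContinuousOn c (Ici a))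
    (hu : ∀ t ∈ Ici a, HasDerivWithinAt u (c t * u t) (Ici a) t) (hua : u a = 0) :
    ∀ t ∈ Ici a, u t = 0 := by
  have hc' : Continuous fun t => c (max a t) :=
    hc.comp_continuous (by fun_prop) fun t => le_max_left a t
  set G : ℝ → ℝ := fun t => ∫ s in a..t, c (max a s)
  have hG : ∀ t ∈ Ici a, HasDerivAt G (c t) t := fun t ht => by
    have h := (hc'.integral_hasStrictDerivAt a t).hasDerivAt
    rwa [max_eq_right (mem_Ici.1 ht)] at h
  have hv : ∀ t ∈ Ici a, HasDerivWithinAt (fun t => u t * Real.exp (-G t)) 0 (Ici a) t := by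
    intro t ht
    refine ((hu t ht).mul (hG t ht).neg.exp.hasDerivWithinAt).congr_deriv ?_
    ring
  intro t ht
  have h := constant_of_has_deriv_right_zero (f := fun t => u t * Real.exp (-G t)) (a := a) (b := t)
    (fun s hs => ((hv s hs.1).continuousWithinAt).mono Icc_subset_Ici_self)
    (fun s hs => (hv s hs.1).mono (Ici_subset_Ici.2 hs.1)) t (right_mem_Icc.2 ht)
  simp only [hua, zero_mul] at h
  exact (mul_eq_zero.1 h).resolve_right (Real.exp_pos _).ne'

section Comparison

variable {a M : ℝ} {P R A φ ψ y : ℝ → ℝ}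

/-- The gap `y - ψ/φ` times `φ²` is the right unknown `u`: its linear terms cancel, leaving `u' =
-(P/φ²) u²`. -/
lemma hasDerivWithinAt_riccati_gap
    (hφ : ∀ t ∈ Ici a, HasDerivWithinAt φ (P t * ψ t) (Ici a) t)
    (hψ : ∀ t ∈ Ici a, HasDerivWithinAt ψ (R t * φ t) (Ici a) t)
    (hy : ∀ t ∈ Ici a, HasDerivWithinAt y (R t - P t * y t ^ 2) (Ici a) t) {t : ℝ}
    (ht : t ∈ Ici a) :
    HasDerivWithinAt (fun t => φ t * (y t * φ t - ψ t)) (-(P t * (y t * φ t - ψ t) ^ 2))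
      (Ici a) t := by
  refine ((hφ t ht).mul (((hy t ht).mul (hφ t ht)).sub (hψ t ht))).congr_deriv ?_
  simp only [Pi.mul_apply, Pi.sub_apply]
  ring

/-- If `u a < 0`, then `u` decreases and stays negative, while `(u⁻¹)' = P/φ² ≥ P/M²`. Since `A →
∞`, this drives `u⁻¹` above zero, a contradiction. -/
lemma principal_le_of_riccati (hP : ∀ t, 0 < P t) (hA : ∀ t, HasDerivAt A (P t) t)
    (hAtop : Tendsto A atTop atTop)
    (hφ : ∀ t ∈ Ici a, HasDerivWithinAt φ (P t * ψ t) (Ici a) t)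
    (hψ : ∀ t ∈ Ici a, HasDerivWithinAt ψ (R t * φ t) (Ici a) t)
    (hφ1 : ∀ t, 1 ≤ φ t) (hφM : ∀ t, φ t ≤ M)
    (hy : ∀ t ∈ Ici a, HasDerivWithinAt y (R t - P t * y t ^ 2) (Ici a) t) :
    ψ a / φ a ≤ y a := by
  by_contra! hlt
  have hφ0 : ∀ t, 0 < φ t := fun t => zero_lt_one.trans_le (hφ1 t)
  set u : ℝ → ℝ := fun t => φ t * (y t * φ t - ψ t) with hu
  have hua : u a < 0 := by
    rw [lt_div_iff₀ (hφ0 a)] at hlt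
    exact mul_neg_of_pos_of_neg (hφ0 a) (by linarith)
  have hud : ∀ t ∈ Ici a, HasDerivWithinAt u (-(P t * (y t * φ t - ψ t) ^ 2)) (Ici a) t :=
    fun t ht => hasDerivWithinAt_riccati_gap hφ hψ hy ht
  have hu0 : ∀ t ∈ Ici a, u t < 0 := by
    have hanti : AntitoneOn u (Ici a) := by
      refine antitoneOn_of_hasDerivWithinAt_nonpos (convex_Ici a)
        (fun t ht => (hud t ht).continuousWithinAt)
        (fun t ht => (hud t (interior_subset ht)).mono interior_subset) fun t _ => ?_
      exact neg_nonpos.2 (mul_nonneg (hP t).le (sq_nonneg _))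
    exact fun t ht => (hanti self_mem_Ici ht ht).trans_lt hua
  have hwd : ∀ t ∈ Ici a, HasDerivWithinAt (fun t => (u t)⁻¹ - A t / M ^ 2)
      (P t / φ t ^ 2 - P t / M ^ 2) (Ici a) t := by
    intro t ht
    have hne := (hu0 t ht).ne
    refine (((hud t ht).inv hne).sub ((hA t).hasDerivWithinAt.div_const _)).congr_deriv ?_
    have h2 : y t * φ t - ψ t ≠ 0 := right_ne_zero_of_mul hne
    have h3 := (hφ0 t).ne'
    rw [sub_left_inj]
    simp only [hu]
    field_simp
  have hmono : MonotoneOn (fun t => (u t)⁻¹ - A t / M ^ 2) (Ici a) := by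
    refine monotoneOn_of_hasDerivWithinAt_nonneg (convex_Ici a)
      (fun t ht => (hwd t ht).continuousWithinAt)
      (fun t ht => (hwd t (interior_subset ht)).mono interior_subset) fun t _ => ?_
    have h1 := pow_le_pow_left₀ (hφ0 t).le (hφM t) 2
    have h2 : 0 < φ t ^ 2 := pow_pos (hφ0 t) 2
    exact sub_nonneg.2 (div_le_div_of_nonneg_left (hP t).le h2 h1)
  have hM : 0 < M ^ 2 := pow_pos ((hφ0 a).trans_le (hφM a)) 2
  obtain ⟨t, hta, htA⟩ := ((eventually_ge_atTop a).and
    (hAtop.eventually_gt_atTop ((A a / M ^ 2 - (u a)⁻¹) * M ^ 2))).exists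
  have h1 := hmono self_mem_Ici hta hta
  have h2 := inv_lt_zero.2 (hu0 t hta)
  rw [← lt_div_iff₀ hM] at htA
  simp only at h1
  linarith

lemma principal_eqOn_of_riccati (hPc : Continuous P)
    (hφ : ∀ t ∈ Ici a, HasDerivWithinAt φ (P t * ψ t) (Ici a) t)
    (hψ : ∀ t ∈ Ici a, HasDerivWithinAt ψ (R t * φ t) (Ici a) t) (hφ1 : ∀ t, 1 ≤ φ t)
    (hy : ∀ t ∈ Ici a, HasDerivWithinAt y (R t - P t * y t ^ 2) (Ici a) t)
    (hya : y a = ψ a / φ a) :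
    ∀ t ∈ Ici a, y t = ψ t / φ t := by
  have hφ0 : ∀ t, φ t ≠ 0 := fun t => (zero_lt_one.trans_le (hφ1 t)).ne'
  have hφc : ContinuousOn φ (Ici a) := fun t ht => (hφ t ht).continuousWithinAt
  have hψc : ContinuousOn ψ (Ici a) := fun t ht => (hψ t ht).continuousWithinAt
  have hyc : ContinuousOn y (Ici a) := fun t ht => (hy t ht).continuousWithinAt
  intro t ht
  have h := eqOn_zero_of_hasDerivWithinAt_mul_self
    -- The quadratic equation for `u` is read as a linear one, with a continuous coefficient
    -- depending on `y`, so a zero initial value forces `u = 0`.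
    (c := fun t => -(P t * (y t * φ t - ψ t)) / φ t)
    (u := fun t => φ t * (y t * φ t - ψ t))
    (((hPc.continuousOn.mul ((hyc.mul hφc).sub hψc)).neg).div hφc fun t _ => hφ0 t)
    (fun t ht => (hasDerivWithinAt_riccati_gap hφ hψ hy ht).congr_deriv (by
      have := hφ0 t
      field_simp)) (by
      rw [hya, div_mul_cancel₀ _ (hφ0 a), sub_self, mul_zero]) t ht
  rw [eq_div_iff (hφ0 t)]
  exact sub_eq_zero.1 ((mul_eq_zero.1 h).resolve_left (hφ0 t))

end Comparison

/-! ### The minimal solution of the reduced Riccati equation -/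

/-- The minimal global solution of `y' = R - P y²` on `[a, ∞)`. -/
theorem exists_minimal_riccati_solution {a : ℝ} {P R A : ℝ → ℝ} (hPc : Continuous P)
    (hP : ∀ t, 0 < P t) (hA : ∀ t, HasDerivAt A (P t) t) (hAa : A a = 0)
    (hAtop : Tendsto A atTop atTop) (hR : Continuous R) (hR0 : ∀ t, 0 ≤ R t)
    (hARi : IntegrableOn (fun u => A u * R u) (Ioi a)) :
    ∃ y : ℝ → ℝ, (∀ t ∈ Ici a, HasDerivWithinAt y (R t - P t * y t ^ 2) (Ici a) t) ∧
      (∀ z : ℝ → ℝ, (∀ t ∈ Ici a, HasDerivWithinAt z (R t - P t * z t ^ 2) (Ici a) t) →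
        y a ≤ z a ∧ (z a = y a → EqOn z y (Ici a))) ∧
      ∃ L : ℝ, Tendsto (fun t => ∫ s in a..t, P s * y s) atTop (𝓝 L) := by
  have hAm : Monotone A := monotone_of_hasDerivAt_nonneg hA fun t => (hP t).le
  have hRi : IntegrableOn R (Ioi a) := by
    -- Beyond `T` one has `A ≥ 1`, so `R ≤ A R` there; on `[a, T]` continuity suffices.
    obtain ⟨T, hTa, hT⟩ := ((eventually_ge_atTop a).and (hAtop.eventually_ge_atTop 1)).exists
    rw [← Ioc_union_Ioi_eq_Ioi hTa]
    refine ((hR.integrableOn_Icc).mono_set Ioc_subset_Icc_self).union ?_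
    refine (hARi.mono_set (Ioi_subset_Ioi hTa)).mono' hR.aestronglyMeasurable ?_
    filter_upwards [ae_restrict_mem measurableSet_Ioi] with u hu
    rw [Real.norm_of_nonneg (hR0 u)]
    exact le_mul_of_one_le_left (hR0 u) (hT.trans (hAm (mem_Ioi.1 hu).le))
  obtain ⟨φ, ψ, M, hφ, hψ, hφ1, hφM, hlim⟩ :=
    exists_principal_solution hP hA hAa hR hR0 hRi hARi
  have hφ0 : ∀ t, φ t ≠ 0 := fun t => (zero_lt_one.trans_le (hφ1 t)).ne'
  have hφc : ContinuousOn φ (Ici a) := fun t ht => (hφ t ht).continuousWithinAt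
  have hψc : ContinuousOn ψ (Ici a) := fun t ht => (hψ t ht).continuousWithinAt
  refine ⟨fun t => ψ t / φ t, fun t ht => ?_, fun z hz =>
    ⟨principal_le_of_riccati hP hA hAtop hφ hψ hφ1 hφM hz, fun h =>
      principal_eqOn_of_riccati hPc hφ hψ hφ1 hz h⟩, -Real.log (φ a), ?_⟩
  · refine ((hψ t ht).div (hφ t ht) (hφ0 t)).congr_deriv ?_
    have := hφ0 t
    field_simp
  · have h1 : Tendsto (fun t => Real.log (φ t) - Real.log (φ a)) atTop
        (𝓝 (-Real.log (φ a))) := by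
      have h := ((Real.continuousAt_log one_ne_zero).tendsto.comp hlim).sub_const (Real.log (φ a))
      rwa [Real.log_one, zero_sub] at h
    refine h1.congr' ?_
    filter_upwards [eventually_ge_atTop a] with t ht
    symm
    have hd : ∀ s ∈ Ici a, HasDerivWithinAt (fun s => Real.log (φ s)) (P s * (ψ s / φ s))
        (Ici a) s := fun s hs => ((hφ s hs).log (hφ0 s)).congr_deriv (by ring)
    refine intervalIntegral.integral_eq_sub_of_hasDeriv_right_of_le ht
      (fun s hs => ((hd s hs.1).continuousWithinAt).mono Icc_subset_Ici_self)
      (fun s hs => (hd s hs.1.le).mono (Ioi_subset_Ici hs.1.le)) ?_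
    refine ContinuousOn.intervalIntegrable ?_
    rw [uIcc_of_le ht]
    exact (hPc.continuousOn.mul (hψc.div hφc fun s _ => hφ0 s)).mono Icc_subset_Ici_self

/-! ### Reduction of the original equation -/

lemma tendsto_atTop_of_lintegral_eq_top {a : ℝ} {P : ℝ → ℝ} (hPc : Continuous P)
    (hP : ∀ t, 0 < P t) (h : ∫⁻ t in Ioi a, ENNReal.ofReal (P t) = ∞) :
    Tendsto (fun t => ∫ s in a..t, P s) atTop atTop := by
  have hmono : Monotone fun t => ∫ s in a..t, P s :=
    monotone_of_hasDerivAt_nonneg (fun t => (hPc.integral_hasStrictDerivAt a t).hasDerivAt)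
      fun t => (hP t).le
  refine (tendsto_atTop_of_monotone hmono).resolve_right ?_
  rintro ⟨l, hl⟩
  have hint : IntegrableOn P (Ioi a) := by
    refine integrableOn_Ioi_of_intervalIntegral_norm_tendsto l a
      (fun t => (hPc.integrableOn_Icc).mono_set Ioc_subset_Icc_self) tendsto_id ?_
    simpa only [Real.norm_of_nonneg (hP _).le, id] using hl
  exact (hint.lintegral_lt_top).ne h

/-- The substitution `y = E α` with `E' = (q / p) E` removes the linear term of the Riccati
equation. -/
lemma IsRegularSolution.hasDerivWithinAt_mul {p q r E α : ℝ → ℝ} {a : ℝ}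
    (hα : IsRegularSolution p q r a α) (hE0 : ∀ t, E t ≠ 0)
    (hE : ∀ t ∈ Ici a, HasDerivAt E (E t * (q t / p t)) t) :
    ∀ t ∈ Ici a, HasDerivWithinAt (fun t => E t * α t)
      (-(r t * E t) - 1 / (p t * E t) * (E t * α t) ^ 2) (Ici a) t := by
  intro t ht
  refine ((hE t ht).hasDerivWithinAt.mul (hα t ht)).congr_deriv ?_
  have h1 : 1 / (p t * E t) * (E t * α t) ^ 2 = 1 / p t * E t * α t ^ 2 := by
    have := hE0 t
    rw [one_div_mul_eq_div, mul_pow, sq (E t), one_div, mul_assoc, mul_comm (p t),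
      mul_div_mul_left _ _ this]
    ring
  rw [h1]
  ring

lemma isRegularSolution_div {p q r E y : ℝ → ℝ} {a : ℝ} (hE0 : ∀ t, E t ≠ 0)
    (hE : ∀ t ∈ Ici a, HasDerivAt E (E t * (q t / p t)) t)
    (hy : ∀ t ∈ Ici a,
      HasDerivWithinAt y (-(r t * E t) - 1 / (p t * E t) * y t ^ 2) (Ici a) t) :
    IsRegularSolution p q r a fun t => y t / E t := by
  intro t ht
  refine ((hy t ht).div (hE t ht).hasDerivWithinAt (hE0 t)).congr_deriv ?_
  have := hE0 t
  -- Positivity of `p` is not assumed here; at a zero of `p` the identity holds by the convention `x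
  -- / 0 = 0`.
  by_cases hp : p t = 0
  · simp only [hp]
    field_simp
    simp
  · field_simp
    ring

theorem lemma2p7 (t₀ : ℝ) (p q r : ℝ → ℝ)
    (hp : ContinuousOn p (Ici t₀)) (hq : ContinuousOn q (Ici t₀)) (hr : ContinuousOn r (Ici t₀))
    (hp_pos : ∀ t ∈ Ici t₀, 0 < p t)
    (ha : ∀ t ∈ Ici t₀, r t ≤ 0)
    (hb : riccatiI p q t₀ = ∞)
    (hc : IntegrableOn
      (fun t => |r t| * ∫ τ in t₀..t, Real.exp (∫ s in τ..t, q s / p s) / p τ) (Ioi t₀)) :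
    ∃ α : ℝ → ℝ, IsLowerExtremalSolution p q r t₀ α ∧
      (∀ β : ℝ → ℝ, IsLowerExtremalSolution p q r t₀ β → EqOn β α (Ici t₀)) ∧
      ∃ L : ℝ, Tendsto (fun t => ∫ τ in t₀..t, α τ / p τ) atTop (𝓝 L) := by
  -- Composing with `max t₀` extends the coefficients continuously to all of `ℝ`.
  have hmax : Continuous fun t => max t₀ t := by fun_prop
  have hmem : ∀ t, max t₀ t ∈ Ici t₀ := fun t => mem_Ici.2 (le_max_left _ _)
  have hp' : Continuous fun t => p (max t₀ t) := hp.comp_continuous hmax hmem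
  have hq' : Continuous fun t => q (max t₀ t) := hq.comp_continuous hmax hmem
  have hr' : Continuous fun t => r (max t₀ t) := hr.comp_continuous hmax hmem
  have hp0 : ∀ t, 0 < p (max t₀ t) := fun t => hp_pos _ (hmem t)
  have hqp : Continuous fun t => q (max t₀ t) / p (max t₀ t) := hq'.div hp' fun t => (hp0 t).ne'
  set F : ℝ → ℝ := fun t => ∫ s in t₀..t, q (max t₀ s) / p (max t₀ s) with hF
  set E : ℝ → ℝ := fun t => Real.exp (F t) with hEdef
  have hFd : ∀ t, HasDerivAt F (q (max t₀ t) / p (max t₀ t)) t := fun t =>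
    (hqp.integral_hasStrictDerivAt t₀ t).hasDerivAt
  have hE : ∀ t ∈ Ici t₀, HasDerivAt E (E t * (q t / p t)) t := fun t ht => by
    have h := (hFd t).exp
    rwa [max_eq_right (mem_Ici.1 ht)] at h
  have hEpos : ∀ t, 0 < E t := fun t => Real.exp_pos _
  have hE0 : ∀ t, E t ≠ 0 := fun t => (hEpos t).ne'
  have hEc : Continuous E :=
    Real.continuous_exp.comp (continuous_iff_continuousAt.2 fun t => (hFd t).continuousAt)
  have hqpi : ∀ x ∈ Ici t₀, ∀ y ∈ Ici t₀, ∫ s in x..y, q s / p s = F y - F x := by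
    intro x hx y hy
    have h1 : ∫ s in x..y, q s / p s = ∫ s in x..y, q (max t₀ s) / p (max t₀ s) := by
      refine intervalIntegral.integral_congr fun s hs => ?_
      have : t₀ ≤ s := (le_min hx hy).trans hs.1
      simp only [max_eq_right this]
    rw [h1, hF, intervalIntegral.integral_interval_sub_left (hqp.intervalIntegrable _ _)
      (hqp.intervalIntegrable _ _)]
  have hF0 : F t₀ = 0 := intervalIntegral.integral_same
  set P : ℝ → ℝ := fun t => 1 / (p (max t₀ t) * E t) with hPdef
  set R : ℝ → ℝ := fun t => -(r (max t₀ t) * E t) with hRdef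
  have hPc : Continuous P :=
    continuous_const.div (hp'.mul hEc) fun t => (mul_pos (hp0 t) (hEpos t)).ne'
  have hP : ∀ t, 0 < P t := fun t => one_div_pos.2 (mul_pos (hp0 t) (hEpos t))
  have hRc : Continuous R := (hr'.mul hEc).neg
  have hR0 : ∀ t, 0 ≤ R t := fun t =>
    neg_nonneg.2 (mul_nonpos_of_nonpos_of_nonneg (ha _ (hmem t)) (hEpos t).le)
  set A : ℝ → ℝ := fun t => ∫ s in t₀..t, P s with hAdef
  have hA : ∀ t, HasDerivAt A (P t) t := fun t => (hPc.integral_hasStrictDerivAt t₀ t).hasDerivAt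
  have hAtop : Tendsto A atTop atTop := by
    refine tendsto_atTop_of_lintegral_eq_top hPc hP ?_
    rw [← hb, riccatiI]
    refine setLIntegral_congr_fun measurableSet_Ioi fun t ht => ?_
    have ht' : t₀ ≤ t := (mem_Ioi.1 ht).le
    simp only [hPdef, hEdef, max_eq_right ht', hqpi t₀ self_mem_Ici t ht', hF0, sub_zero,
      Real.exp_neg]
    congr 1
    rw [one_div, mul_inv, mul_comm, div_eq_mul_inv]
  have hARi : IntegrableOn (fun u => A u * R u) (Ioi t₀) := by
    refine hc.congr_fun (fun t ht => ?_) measurableSet_Ioi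
    have ht' : t₀ ≤ t := (mem_Ioi.1 ht).le
    -- The inner integral in c) factors as `E t * A t`, so the integrand there is exactly `A R`.
    have h1 : ∫ τ in t₀..t, Real.exp (∫ s in τ..t, q s / p s) / p τ = E t * A t := by
      rw [hAdef, ← intervalIntegral.integral_const_mul]
      refine intervalIntegral.integral_congr fun τ hτ => ?_
      rw [uIcc_of_le ht'] at hτ
      simp only [hqpi τ hτ.1 t ht', hPdef, hEdef, max_eq_right hτ.1, Real.exp_sub]
      rw [one_div, mul_inv]
      ring
    simp only [h1, abs_of_nonpos (ha t ht'), hRdef, max_eq_right ht']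
    ring
  obtain ⟨y, hy, hmin, L, hL⟩ := exists_minimal_riccati_solution hPc hP hA
    intervalIntegral.integral_same hAtop hRc hR0 hARi
  have hcoef : ∀ t ∈ Ici t₀, ∀ x : ℝ,
      R t - P t * x ^ 2 = -(r t * E t) - 1 / (p t * E t) * x ^ 2 := fun t ht x => by
    simp only [hRdef, hPdef, max_eq_right (mem_Ici.1 ht)]
  have hreg : IsRegularSolution p q r t₀ fun t => y t / E t :=
    isRegularSolution_div hE0 hE fun t ht => (hy t ht).congr_deriv (hcoef t ht _)
  have hβ : ∀ β, IsRegularSolution p q r t₀ β → ∀ t ∈ Ici t₀,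
      HasDerivWithinAt (fun t => E t * β t) (R t - P t * (E t * β t) ^ 2) (Ici t₀) t :=
    fun β h t ht => (h.hasDerivWithinAt_mul hE0 hE t ht).congr_deriv (hcoef t ht _).symm
  have hle : ∀ β, IsRegularSolution p q r t₀ β → y t₀ / E t₀ ≤ β t₀ := fun β h => by
    rw [div_le_iff₀' (hEpos t₀)]
    exact (hmin _ (hβ β h)).1
  refine ⟨fun t => y t / E t, ⟨⟨hreg, ?_⟩, fun β hlt h => (hle β h).not_gt hlt⟩,
    fun β h t ht => ?_, L, hL.congr' ?_⟩
  -- Every neighbourhood of the minimal initial value contains smaller values, from which no regular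
  -- solution starts.
  · rintro ⟨-, U, hU, hUreg⟩
    obtain ⟨x, hx, hxU⟩ := ((eventually_mem_nhdsWithin : ∀ᶠ x in 𝓝[<] (y t₀ / E t₀), _).and
      (mem_nhdsWithin_of_mem_nhds hU)).exists
    obtain ⟨β, hβreg, hβx⟩ := hUreg x hxU
    exact ((hle β hβreg).trans_eq hβx).not_gt hx
  · have h1 : β t₀ = y t₀ / E t₀ :=
      le_antisymm (not_lt.1 fun hlt => h.2 _ hlt hreg) (hle β h.1.1)
    have h2 := (hmin _ (hβ β h.1.1)).2 (by rw [h1, mul_div_cancel₀ _ (hE0 t₀)]) ht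
    exact (eq_div_iff (hE0 t)).2 ((mul_comm _ _).trans h2)
  · filter_upwards [eventually_ge_atTop t₀] with t ht
    refine intervalIntegral.integral_congr fun s hs => ?_
    rw [uIcc_of_le ht] at hs
    simp only [hPdef, max_eq_right hs.1]
    rw [one_div, mul_inv]
    ring
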